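/- Let $\Omega\subseteq\mathbb R^3$ be a simply connected domain (a non-empty, path-connected open set in which every closed curve can be shrunk to a point within $\Omega$). Let $P,Q,R$ be real functions that are differentiable at every point of $\Omega$, and let $\vec A=(P,Q,R)$. Curves are piecewise $C^1$ parametric curves. Then the following four conditions are equivalent: (a) $\oint_C P\,dx+Q\,dy+R\,dz=0$ for every closed curve $C$ in $\Omega$; (b) for any two distinct points $a,b\in\Omega$, the integral $\int_L P\,dx+Q\,dy+R\,dz$ has the same value for all curves $L$ in $\Omega$ from $a$ to $b$; (c) there is a function $u$, differentiable in $\Omega$, such that $\vec A=\nabla u$ at every point of $\Omega$; (d) at every point of $\Omega$, $\nabla\times\vec A=0$, i.e. $\frac{\partial P}{\partial y}=\frac{\partial Q}{\partial x}$, $\frac{\partial P}{\partial z}=\frac{\partial R}{\partial x}$, $\frac{\partial Q}{\partial z}=\frac{\partial R}{\partial y}$. Moreover, for every function $u$ the following are equivalent: $u$ is differentiable in $\Omega$ with $\nabla u=\vec A$ there; $u$ is differentiable in $\Omega$ with $du=P\,dx+Q\,dy+R\,dz$ there; the partial derivatives of $u$ exist in $\Omega$ and $\frac{\partial u}{\partial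 x}=P$, $\frac{\partial u}{\partial y}=Q$, $\frac{\partial u}{\partial z}=R$ there. In particular, an irrotational field ((d)) on a simply connected domain is potential ((c)). -/

import Mathlib

open scoped unitInterval

noncomputable section

namespace SpaceField

/-- Euclidean space with coordinates `x = p 0`, `y = p 1`, `z = p 2`. -/
abbrev E3 : Type := EuclideanSpace ℝ (Fin 3)

/-- The unit vector along the `i`-th coordinate axis. -/
def axis (i : Fin 3) : E3 := EuclideanSpace.single i 1

/-- The partial derivative `∂f/∂xᵢ` at the point `p`. -/
def partialDeriv (i : Fin 3) (f : E3 → ℝ) (p : E3) : ℝ := lineDeriv ℝ f p (axis i)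

/-- The vector field `A = (P, Q, R)`. -/
def field (P Q R : E3 → ℝ) (p : E3) : E3 := !₂[P p, Q p, R p]

/-- The differential expression `P dx + Q dy + R dz`, as a field of linear forms. -/
def form (P Q R : E3 → ℝ) (p : E3) : E3 →L[ℝ] ℝ :=
  P p • (EuclideanSpace.proj 0 : E3 →L[ℝ] ℝ) + Q p • (EuclideanSpace.proj 1 : E3 →L[ℝ] ℝ)
    + R p • (EuclideanSpace.proj 2 : E3 →L[ℝ] ℝ)

/-- The curl of a vector field:
`(∂R/∂y - ∂Q/∂z, ∂P/∂z - ∂R/∂x, ∂Q/∂x - ∂P/∂y)` for the field `(P, Q, R)`. -/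
def curl (A : E3 → E3) (p : E3) : E3 :=
  !₂[partialDeriv 1 (fun q => A q 2) p - partialDeriv 2 (fun q => A q 1) p,
     partialDeriv 2 (fun q => A q 0) p - partialDeriv 0 (fun q => A q 2) p,
     partialDeriv 0 (fun q => A q 1) p - partialDeriv 1 (fun q => A q 0) p]

/-- A parametric curve is piecewise `C¹` if its parameter interval `[0, 1]` has a partition
`0 = t₀ < t₁ < ⋯ < tₙ = 1` such that the curve is continuously differentiable
on each closed interval `[tᵢ, tᵢ₊₁]` (with one-sided derivatives at the end points). -/
def IsPiecewiseC1 {a b : E3} (γ : Path a b) : Prop :=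
  ∃ (n : ℕ) (t : Fin (n + 1) → ℝ), StrictMono t ∧ t 0 = 0 ∧ t (Fin.last n) = 1 ∧
    ∀ i : Fin n, ContDiffOn ℝ 1 γ.extend (Set.Icc (t i.castSucc) (t i.succ))

/-- `γ` is a piecewise `C¹` curve that lies in `Ω`. -/
def IsCurveIn (Ω : Set E3) {a b : E3} (γ : Path a b) : Prop :=
  IsPiecewiseC1 γ ∧ ∀ s : I, γ s ∈ Ω

/-- `∮_C P dx + Q dy + R dz = 0` for every closed curve `C` in `Ω`. -/
def ClosedIntegralsVanish (Ω : Set E3) (P Q R : E3 → ℝ) : Prop :=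
  ∀ (a : E3) (C : Path a a), IsCurveIn Ω C → curveIntegral (form P Q R) C = 0

/-- `∫_L P dx + Q dy + R dz` does not depend on the curve `L` in `Ω` that connects two given points.
The points are distinct, so that the curves are open; the case of equal end points is
that of closed curves. -/
def IsPathIndependent (Ω : Set E3) (P Q R : E3 → ℝ) : Prop :=
  ∀ a ∈ Ω, ∀ b ∈ Ω, a ≠ b → ∀ L₁ L₂ : Path a b, IsCurveIn Ω L₁ → IsCurveIn Ω L₂ →
    curveIntegral (form P Q R) L₁ = curveIntegral (form P Q R) L₂

/-- `u` is a potential of `(P, Q, R)` on `Ω`: it is differentiable there and `∇u = (P, Q, R)`. -/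
def IsPotentialOf (Ω : Set E3) (P Q R u : E3 → ℝ) : Prop :=
  ∀ p ∈ Ω, HasGradientAt u (field P Q R p) p

/-- `u` is differentiable on `Ω` and `du = P dx + Q dy + R dz`. -/
def HasDifferential (Ω : Set E3) (P Q R u : E3 → ℝ) : Prop :=
  ∀ p ∈ Ω, HasFDerivAt u (form P Q R p) p

/-- On `Ω`, the partial derivatives of `u` exist and `∂u/∂x = P`, `∂u/∂y = Q`, `∂u/∂z = R`. -/
def HasPartials (Ω : Set E3) (P Q R u : E3 → ℝ) : Prop :=
  ∀ p ∈ Ω, HasLineDerivAt ℝ u (P p) p (axis 0) ∧ HasLineDerivAt ℝ u (Q p) p (axis 1) ∧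
    HasLineDerivAt ℝ u (R p) p (axis 2)

/-- The field `(P, Q, R)` is irrotational on `Ω`. -/
def IsIrrotational (Ω : Set E3) (P Q R : E3 → ℝ) : Prop :=
  ∀ p ∈ Ω, curl (field P Q R) p = 0

end SpaceField

end

/-! ### Gluing local primitives. -/

section

open Set Filter Topology

/-! Closed curves and pairs of curves are exchanged by concatenation and reversal, which gives (a) ⇔
(b), and the fundamental theorem of calculus gives (c) ⇒ (a). For (a) ⇒ (d), integration along
segments in a ball yields a local primitive; its derivative is the form, which is itself
differentiable, and symmetry of the second derivative says that the curl vanishes.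

The only global step is (d) ⇒ (c). The Poincaré lemma gives a primitive on each ball. Two local
primitives differ by a locally constant function, and these differences form a Čech cocycle, hence a
covering space with fibre `ℝ`. Over a simply connected base it has a global section, which corrects
the local primitives so that they agree (`exists_eventually_eq_coboundary`,
`IsSimplyConnected.exists_forall_hasFDerivAt`). No integration over homotopies is needed, so
differentiable coefficients suffice.

The three descriptions of a potential agree because partial derivatives that are continuous
determine the differential (`hasFDerivAt_of_hasPartials`). -/

/-- On a simply connected, locally path connected space, every locally constant Čech 1-cocycle
is the coboundary of a locally constant 0-cochain. -/
theorem exists_eventually_eq_coboundary {ι X G : Type*} [TopologicalSpace X]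
    [SimplyConnectedSpace X] [LocallyPathConnectedSpace X] [AddGroup G] {U : ι → Set X}
    (hU : ∀ i, IsOpen (U i)) (hcov : ∀ x, ∃ i, x ∈ U i) (c : ι → ι → X → G)
    (hc : ∀ i j, ∀ x ∈ U i ∩ U j, ∀ᶠ y in 𝓝 x, c i j y = c i j x)
    (hcomp : ∀ i j k, ∀ x ∈ U i ∩ U j ∩ U k, c i j x + c j k x = c i k x) :
    ∃ s : ι → X → G, (∀ i, ∀ x ∈ U i, ∀ᶠ y in 𝓝 x, s i y = s i x) ∧
      ∀ i j, ∀ x ∈ U i ∩ U j, s j x = s i x + c i j x := by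
  let _ : TopologicalSpace G := ⊥
  have : DiscreteTopology G := ⟨rfl⟩
  choose idx hidx using hcov
  have hself (i : ι) (x : X) (hx : x ∈ U i) : c i i x = 0 := by
    simpa using hcomp i i i x ⟨⟨hx, hx⟩, hx⟩
  -- The cocycle is the gluing data of a bundle with discrete fibre `G`; such a bundle is a
  -- covering.
  let Z : FiberBundleCore ι X G :=
    { baseSet := U
      isOpen_baseSet := hU
      indexAt := idx
      mem_baseSet_at := hidx
      coordChange := fun i j x v => v + c i j x
      coordChange_self := fun i x hx v => by rw [hself i x hx, add_zero]
      continuousOn_coordChange := fun i j => by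
        have h : ContinuousOn (c i j) (U i ∩ U j) := fun x hx =>
          (continuousAt_const.congr ((hc i j x hx).mono fun _ h => h.symm)).continuousWithinAt
        exact (continuous_of_discreteTopology (f := fun q : G × G => q.1 + q.2)).comp_continuousOn
          (continuousOn_snd.prodMk (h.comp continuousOn_fst fun p hp => hp.1))
      coordChange_comp := fun i j k x hx v => by rw [add_assoc, hcomp i j k x hx] }
  have hcovering : IsCoveringMap Z.proj :=
    IsCoveringMap.mk Z.proj (fun _ => G) Z.localTrivAt fun x => hidx x
  obtain ⟨x₀⟩ : Nonempty X := inferInstance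
  -- Lifting the identity of `X` gives a global section; its expression in the `i`-th chart is the
  -- cochain.
  obtain ⟨S, ⟨-, hS⟩, -⟩ := hcovering.existsUnique_continuousMap_lifts (ContinuousMap.id X) x₀
    (⟨x₀, (0 : G)⟩ : Z.TotalSpace) rfl
  have hSx (x : X) : (S x).proj = x := congrFun hS x
  refine ⟨fun i x => (Z.localTriv i (S x)).2, fun i x hx => ?_, fun i j x hx => ?_⟩
  · have h1 : ContinuousAt (Z.localTriv i) (S x) :=
      (Z.localTriv i).continuousAt <| by
        rw [(Z.localTriv i).mem_source]
        change (S x).proj ∈ U i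
        rwa [hSx]
    have h2 : ContinuousAt (fun y => (Z.localTriv i (S y)).2) x :=
      continuousAt_snd.comp (ContinuousAt.comp (f := S) h1 S.continuous.continuousAt)
    rw [ContinuousAt, nhds_discrete G, tendsto_pure] at h2
    exact h2
  · let v : G := (S x).2
    change v + c (idx (S x).proj) j (S x).proj = v + c (idx (S x).proj) i (S x).proj + c i j x
    rw [hSx, add_assoc, hcomp _ i j x ⟨⟨hidx x, hx.1⟩, hx.2⟩]

/-- Local primitives of a 1-form on a simply connected open set glue to a global primitive. -/
theorem IsSimplyConnected.exists_forall_hasFDerivAt {E F : Type*} [NormedAddCommGroup E]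
    [NormedSpace ℝ E] [NormedAddCommGroup F] [NormedSpace ℝ F] {Ω : Set E} (hΩ : IsOpen Ω)
    (hsc : IsSimplyConnected Ω) {ω : E → E →L[ℝ] F}
    (h : ∀ p ∈ Ω, ∃ f : E → F, ∀ᶠ q in 𝓝 p, HasFDerivAt f (ω q) q) :
    ∃ u : E → F, ∀ p ∈ Ω, HasFDerivAt u (ω p) p := by
  classical
  have := hsc.simplyConnectedSpace
  have : LocallyPathConnectedSpace Ω := hΩ.locallyPathConnectedSpace
  have h' (p : Ω) : ∃ f : E → F, ∃ V : Set E, IsOpen V ∧ (p : E) ∈ V ∧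
      ∀ q ∈ V, HasFDerivAt f (ω q) q := by
    obtain ⟨f, hf⟩ := h p p.2
    obtain ⟨V, hV, hVo, hpV⟩ := eventually_nhds_iff.1 hf
    exact ⟨f, V, hVo, hpV, hV⟩
  choose f V hVo hpV hf using h'
  have hconst (i j : Ω) (x : E) (hi : x ∈ V i) (hj : x ∈ V j) :
      ∀ᶠ y in 𝓝 x, f j y - f i y = f j x - f i x := by
    obtain ⟨ε, hε, hball⟩ := Metric.isOpen_iff.1 ((hVo i).inter (hVo j)) x ⟨hi, hj⟩
    filter_upwards [Metric.ball_mem_nhds x hε] with y hy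
    refine (convex_ball x ε).is_const_of_fderivWithin_eq_zero (𝕜 := ℝ)
      (f := fun y => f j y - f i y) (fun z hz => ?_) (fun z hz => ?_) hy
      (Metric.mem_ball_self hε)
    · exact ((hf j z (hball hz).2).sub
        (hf i z (hball hz).1)).differentiableAt.differentiableWithinAt
    · have := ((hf j z (hball hz).2).sub (hf i z (hball hz).1))
      rw [sub_self] at this
      exact this.hasFDerivWithinAt.fderivWithin (Metric.isOpen_ball.uniqueDiffOn z hz)
  obtain ⟨s, hs, hsc⟩ := exists_eventually_eq_coboundary (X := Ω) (U := fun i => Subtype.val ⁻¹' V i)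
    (fun i => (hVo i).preimage continuous_subtype_val) (fun x => ⟨x, hpV x⟩)
    (fun i j x => f j x - f i x)
    (fun i j x hx => continuous_subtype_val.continuousAt.eventually (hconst i j x hx.1 hx.2))
    (fun i j k x _ => by abel)
  -- As `s j - s i = f j - f i` on overlaps, the functions `f i - s i` agree there, so each point
  -- may serve as its own index.
  refine ⟨fun x => if hx : x ∈ Ω then f ⟨x, hx⟩ x - s ⟨x, hx⟩ ⟨x, hx⟩ else 0, fun p hp => ?_⟩
  refine ((hf ⟨p, hp⟩ p (hpV _)).sub_const (s ⟨p, hp⟩ ⟨p, hp⟩)).congr_of_eventuallyEq ?_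
  have hs' := hs ⟨p, hp⟩ ⟨p, hp⟩ (hpV _)
  rw [nhds_subtype_eq_comap, eventually_comap] at hs'
  filter_upwards [hs', hΩ.mem_nhds hp, (hVo ⟨p, hp⟩).mem_nhds (hpV ⟨p, hp⟩)] with x hx hxΩ hxV
  rw [dif_pos hxΩ, ← hx ⟨x, hxΩ⟩ rfl, hsc ⟨p, hp⟩ ⟨x, hxΩ⟩ ⟨x, hxΩ⟩ ⟨hxV, hpV _⟩]
  abel

/-! ### Coordinates: gradient, differential and curl. -/

namespace SpaceField

@[simp]
theorem form_apply (P Q R : E3 → ℝ) (p v : E3) :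
    form P Q R p v = P p * v 0 + Q p * v 1 + R p * v 2 := by
  simp [form]

theorem hasGradientAt_field_iff {P Q R u : E3 → ℝ} {p : E3} :
    HasGradientAt u (field P Q R p) p ↔ HasFDerivAt u (form P Q R p) p := by
  have : InnerProductSpace.toDual ℝ E3 (field P Q R p) = form P Q R p := by
    ext v
    simp [field, PiLp.inner_apply, Fin.sum_univ_three, mul_comm]
  rw [HasGradientAt, HasGradientAtFilter, this]
  rfl

theorem eq_sum_axis (v : E3) : v = v 0 • axis 0 + v 1 • axis 1 + v 2 • axis 2 := by
  ext i
  fin_cases i <;> simp [axis]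

theorem form_axis (P Q R : E3 → ℝ) (p : E3) :
    form P Q R p (axis 0) = P p ∧ form P Q R p (axis 1) = Q p ∧ form P Q R p (axis 2) = R p := by
  simp [axis]

theorem partialDeriv_eq_fderiv {f : E3 → ℝ} {p : E3} (hf : DifferentiableAt ℝ f p) (i : Fin 3) :
    partialDeriv i f p = fderiv ℝ f p (axis i) :=
  hf.lineDeriv_eq_fderiv

theorem hasFDerivAt_form {P Q R : E3 → ℝ} {p : E3} (hP : DifferentiableAt ℝ P p)
    (hQ : DifferentiableAt ℝ Q p) (hR : DifferentiableAt ℝ R p) :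
    HasFDerivAt (form P Q R)
      ((fderiv ℝ P p).smulRight (EuclideanSpace.proj 0 : E3 →L[ℝ] ℝ)
        + (fderiv ℝ Q p).smulRight (EuclideanSpace.proj 1 : E3 →L[ℝ] ℝ)
        + (fderiv ℝ R p).smulRight (EuclideanSpace.proj 2 : E3 →L[ℝ] ℝ)) p :=
  ((hP.hasFDerivAt.smul_const (EuclideanSpace.proj 0 : E3 →L[ℝ] ℝ)).add
    (hQ.hasFDerivAt.smul_const (EuclideanSpace.proj 1 : E3 →L[ℝ] ℝ))).add
    (hR.hasFDerivAt.smul_const (EuclideanSpace.proj 2 : E3 →L[ℝ] ℝ))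

theorem fderiv_form_apply {P Q R : E3 → ℝ} {p : E3} (hP : DifferentiableAt ℝ P p)
    (hQ : DifferentiableAt ℝ Q p) (hR : DifferentiableAt ℝ R p) (v w : E3) :
    fderiv ℝ (form P Q R) p v w =
      fderiv ℝ P p v * w 0 + fderiv ℝ Q p v * w 1 + fderiv ℝ R p v * w 2 := by
  rw [(hasFDerivAt_form hP hQ hR).fderiv]
  simp

/-- The curl vanishes at `p` if and only if `P dx + Q dy + R dz` is closed at `p`. -/
theorem curl_eq_zero_iff {P Q R : E3 → ℝ} {p : E3} (hP : DifferentiableAt ℝ P p)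
    (hQ : DifferentiableAt ℝ Q p) (hR : DifferentiableAt ℝ R p) :
    curl (field P Q R) p = 0 ↔
      ∀ v w, fderiv ℝ (form P Q R) p v w = fderiv ℝ (form P Q R) p w v := by
  have hcurl : curl (field P Q R) p = 0 ↔
      fderiv ℝ R p (axis 1) = fderiv ℝ Q p (axis 2) ∧
      fderiv ℝ P p (axis 2) = fderiv ℝ R p (axis 0) ∧
      fderiv ℝ Q p (axis 0) = fderiv ℝ P p (axis 1) := by
    rw [← partialDeriv_eq_fderiv hR, ← partialDeriv_eq_fderiv hQ, ← partialDeriv_eq_fderiv hP,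
      ← partialDeriv_eq_fderiv hR, ← partialDeriv_eq_fderiv hQ, ← partialDeriv_eq_fderiv hP]
    simp only [← sub_eq_zero (b := partialDeriv 2 Q p), ← sub_eq_zero (b := partialDeriv 0 R p),
      ← sub_eq_zero (b := partialDeriv 1 P p)]
    constructor
    · intro h
      exact ⟨congrArg (fun x : E3 => x 0) h, congrArg (fun x : E3 => x 1) h,
        congrArg (fun x : E3 => x 2) h⟩
    · rintro ⟨h0, h1, h2⟩
      ext i
      fin_cases i
      exacts [h0, h1, h2]
  rw [hcurl]
  constructor
  · rintro ⟨h0, h1, h2⟩ v w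
    have hexp (f : E3 → ℝ) (v : E3) : fderiv ℝ f p v = v 0 * fderiv ℝ f p (axis 0)
        + v 1 * fderiv ℝ f p (axis 1) + v 2 * fderiv ℝ f p (axis 2) := by
      conv_lhs => rw [eq_sum_axis v]
      simp
    rw [fderiv_form_apply hP hQ hR, fderiv_form_apply hP hQ hR, hexp P v, hexp Q v, hexp R v,
      hexp P w, hexp Q w, hexp R w, h0, h1, h2]
    ring
  · intro h
    simp only [fderiv_form_apply hP hQ hR] at h
    refine ⟨?_, ?_, ?_⟩
    · simpa [axis] using h (axis 1) (axis 2)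
    · simpa [axis] using h (axis 2) (axis 0)
    · simpa [axis] using h (axis 0) (axis 1)

/-! ### From partial derivatives to the differential. -/

/-- If the partial derivative of `u` in the direction `v` is `δ`-close to `c` along a segment, then
the increment of `u` along it is approximated by the linear one. -/
theorem abs_sub_sub_le_of_hasLineDerivAt {u g : E3 → ℝ} {q v : E3} {h c δ : ℝ}
    (hu : ∀ t ∈ uIcc 0 h, HasLineDerivAt ℝ u (g (q + t • v)) (q + t • v) v)
    (hg : ∀ t ∈ uIcc 0 h, |g (q + t • v) - c| ≤ δ) :
    |u (q + h • v) - u q - h * c| ≤ δ * |h| := by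
  have hd (t : ℝ) (ht : t ∈ uIcc 0 h) :
      HasDerivWithinAt (fun t : ℝ => u (q + t • v) - t * c) (g (q + t • v) - c) (uIcc 0 h) t := by
    -- The base point is written `t - t` to match the composition with `s ↦ s - t`.
    have h1 : HasDerivAt (fun s : ℝ => u (q + t • v + s • v)) (g (q + t • v)) (t - t) := by
      rw [sub_self]
      exact hu t ht
    have h2 := h1.comp (h := fun s => s - t) t ((hasDerivAt_id t).sub_const t)
    have h3 : HasDerivAt (fun s : ℝ => u (q + s • v)) (g (q + t • v)) t := by
      refine (h2.congr_deriv (mul_one _)).congr_of_eventuallyEq (.of_forall fun s => ?_)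
      simp only [Function.comp_apply, add_assoc, ← add_smul]
      congr 3
      ring
    exact ((h3.sub ((hasDerivAt_id t).mul_const c)).congr_deriv
      (by rw [one_mul])).hasDerivWithinAt
  have := (convex_uIcc (0 : ℝ) h).norm_image_sub_le_of_norm_hasDerivWithin_le hd
    (fun t ht => hg t ht) left_mem_uIcc right_mem_uIcc
  simp only [zero_smul, add_zero, zero_mul, sub_zero, Real.norm_eq_abs] at this
  convert this using 2
  ring

/-- By Pythagoras the norm grows with `|t|`. This keeps the axis-parallel path from `p` to `p + v`
inside a ball. -/
theorem norm_add_smul_axis_lt {w : E3} {ε t a : ℝ} {i : Fin 3} (hw : w i = 0)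
    (ht : t ∈ uIcc 0 a) (hε : ‖w + a • axis i‖ < ε) : ‖w + t • axis i‖ < ε := by
  refine lt_of_le_of_lt ?_ hε
  have ht' : |t| ≤ |a| := by simpa using abs_sub_left_of_mem_uIcc ht
  have key (s : ℝ) : ‖w + s • axis i‖ ^ 2 = ‖w‖ ^ 2 + s ^ 2 := by
    have h : inner ℝ w (s • axis i) = 0 := by
      rw [real_inner_smul_right, axis, EuclideanSpace.inner_single_right]
      simp [hw]
    rw [norm_add_sq_real, h, norm_smul]
    simp [axis]
  exact le_of_sq_le_sq (by rw [key, key]; have := sq_le_sq.2 ht'; linarith) (norm_nonneg _)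

/-- A function whose partial derivatives exist near `p` and are continuous at `p`
is differentiable at `p`. -/
theorem hasFDerivAt_of_hasPartials {P Q R u : E3 → ℝ} {p : E3}
    (h : ∀ᶠ q in 𝓝 p, HasLineDerivAt ℝ u (P q) q (axis 0) ∧ HasLineDerivAt ℝ u (Q q) q (axis 1) ∧
      HasLineDerivAt ℝ u (R q) q (axis 2))
    (hP : ContinuousAt P p) (hQ : ContinuousAt Q p) (hR : ContinuousAt R p) :
    HasFDerivAt u (form P Q R p) p := by
  rw [hasFDerivAt_iff_isLittleO_nhds_zero, Asymptotics.isLittleO_iff]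
  intro c hc
  -- Each of the three axis-parallel segments contributes an error of at most `c / 3 * ‖v‖`.
  have hc3 : 0 < c / 3 := by positivity
  obtain ⟨ε, hε, hball⟩ := Metric.eventually_nhds_iff.1 (h.and
    ((hP.eventually (Metric.closedBall_mem_nhds _ hc3)).and
      ((hQ.eventually (Metric.closedBall_mem_nhds _ hc3)).and
        (hR.eventually (Metric.closedBall_mem_nhds _ hc3)))))
  simp only [Real.dist_eq] at hball
  filter_upwards [Metric.ball_mem_nhds (0 : E3) hε] with v hv
  have hv : ‖v‖ < ε := by simpa using hv
  have hmem {w : E3} (hw : ‖w‖ < ε) : dist (p + w) p < ε := by simpa [dist_eq_norm] using hw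
  have e1 : ‖v 0 • axis 0 + v 1 • axis 1‖ ≤ ‖v‖ := by
    simp only [EuclideanSpace.norm_eq]
    refine Real.sqrt_le_sqrt ?_
    simp [axis, Fin.sum_univ_three, sq_nonneg]
  have e0 : ‖v 0 • axis 0‖ ≤ ‖v‖ := by
    simp only [EuclideanSpace.norm_eq]
    refine Real.sqrt_le_sqrt ?_
    simp [axis, Fin.sum_univ_three]
    nlinarith [sq_nonneg (v 1), sq_nonneg (v 2)]
  have b0 (t : ℝ) (ht : t ∈ uIcc 0 (v 0)) : dist (p + t • axis 0) p < ε := by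
    have := hmem (norm_add_smul_axis_lt (w := 0) (i := 0) (by simp) ht
      (by simpa using e0.trans_lt hv))
    rwa [zero_add] at this
  have b1 (t : ℝ) (ht : t ∈ uIcc 0 (v 1)) : dist (p + v 0 • axis 0 + t • axis 1) p < ε := by
    rw [add_assoc]
    exact hmem (norm_add_smul_axis_lt (by simp [axis]) ht (e1.trans_lt hv))
  have b2 (t : ℝ) (ht : t ∈ uIcc 0 (v 2)) :
      dist (p + (v 0 • axis 0 + v 1 • axis 1) + t • axis 2) p < ε := by
    rw [add_assoc]
    exact hmem (norm_add_smul_axis_lt (by simp [axis]) ht (by rwa [← eq_sum_axis]))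
  have d0 := abs_sub_sub_le_of_hasLineDerivAt (u := u) (g := P) (c := P p) (δ := c / 3)
    (fun t ht => (hball (b0 t ht)).1.1) (fun t ht => (hball (b0 t ht)).2.1)
  have d1 := abs_sub_sub_le_of_hasLineDerivAt (u := u) (g := Q) (c := Q p) (δ := c / 3)
    (fun t ht => (hball (b1 t ht)).1.2.1) (fun t ht => (hball (b1 t ht)).2.2.1)
  have d2 := abs_sub_sub_le_of_hasLineDerivAt (u := u) (g := R) (c := R p) (δ := c / 3)
    (fun t ht => (hball (b2 t ht)).1.2.2) (fun t ht => (hball (b2 t ht)).2.2.2)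
  have hsum : p + v = p + (v 0 • axis 0 + v 1 • axis 1) + v 2 • axis 2 := by
    rw [add_assoc, ← eq_sum_axis]
  rw [hsum, form_apply, Real.norm_eq_abs]
  rw [add_assoc p] at d1
  have n (i : Fin 3) : c / 3 * |v i| ≤ c / 3 * ‖v‖ :=
    mul_le_mul_of_nonneg_left (PiLp.norm_apply_le v i) hc3.le
  have n0 := n 0
  have n1 := n 1
  have n2 := n 2
  rw [abs_le] at *
  constructor <;> linarith [d0.1, d0.2, d1.1, d1.2, d2.1, d2.2]

/-! ### Piecewise `C¹` curves. -/

variable {a b c : E3}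

/-- A curve is piecewise `C¹` if and only if it is `C¹` on the closed intervals
whose interior avoids some finite set of exceptional parameters. -/
theorem isPiecewiseC1_iff_exists_finset {γ : Path a b} :
    IsPiecewiseC1 γ ↔ ∃ s : Finset ℝ, ∀ x y, 0 ≤ x → y ≤ 1 → x < y →
      Disjoint (Ioo x y) (s : Set ℝ) → ContDiffOn ℝ 1 γ.extend (Icc x y) := by
  classical
  constructor
  · rintro ⟨n, t, ht, h0, h1, hγ⟩
    refine ⟨Finset.univ.image t, fun x y hx hy hxy hd => ?_⟩
    have havoid (i : Fin (n + 1)) : t i ≤ x ∨ y ≤ t i := by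
      by_contra! h
      exact disjoint_left.1 hd h (by simp)
    have hex : ∃ i : Fin (n + 1), y ≤ t i := ⟨Fin.last n, by rwa [h1]⟩
    -- For the first partition point at or beyond `y`, its predecessor lies before `y`, hence at or
    -- before `x`.
    obtain ⟨i, hi, hmin⟩ : ∃ i : Fin (n + 1), y ≤ t i ∧ ∀ j < i, ¬ y ≤ t j :=
      ⟨Fin.find _ hex, Fin.find_spec hex, fun j hj => Fin.find_min hex hj⟩
    have hi0 : i ≠ 0 := by
      rintro rfl
      linarith
    obtain ⟨k, rfl⟩ := Fin.exists_succ_eq.2 hi0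
    exact (hγ k).mono (Icc_subset_Icc
      ((havoid k.castSucc).resolve_right (hmin _ k.castSucc_lt_succ)) hi)
  · rintro ⟨s, hs⟩
    let S : Finset ℝ := insert 0 (insert 1 (s.filter (· ∈ Icc 0 1)))
    have hS : ∀ x ∈ S, 0 ≤ x ∧ x ≤ 1 := by
      simp only [S, Finset.mem_insert, Finset.mem_filter]
      rintro x (rfl | rfl | h)
      exacts [⟨le_rfl, zero_le_one⟩, ⟨zero_le_one, le_rfl⟩, h.2]
    obtain ⟨n, hn⟩ : ∃ n, S.card = n + 1 :=
      ⟨S.card - 1, (Nat.sub_add_cancel (Finset.card_pos.2 ⟨0, by simp [S]⟩)).symm⟩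
    let t := S.orderEmbOfFin hn
    have hr : range t = S := S.range_orderEmbOfFin hn
    have hmem (i : Fin (n + 1)) : t i ∈ S := S.orderEmbOfFin_mem hn i
    have hsurj (x : ℝ) (hx : x ∈ S) : ∃ i, t i = x := by
      rw [← Finset.mem_coe, ← hr] at hx
      exact hx
    have h0 : t 0 = 0 := by
      obtain ⟨i, hi⟩ := hsurj 0 (by simp [S])
      exact le_antisymm (hi ▸ t.monotone (Fin.zero_le i)) (hS _ (hmem 0)).1
    have h1 : t (Fin.last n) = 1 := by
      obtain ⟨i, hi⟩ := hsurj 1 (by simp [S])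
      exact le_antisymm (hS _ (hmem _)).2 (hi ▸ t.monotone (Fin.le_last i))
    refine ⟨n, t, t.strictMono, h0, h1, fun i => hs _ _ (hS _ (hmem _)).1 (hS _ (hmem _)).2
      (t.strictMono i.castSucc_lt_succ) (disjoint_left.2 fun x hx hxs => ?_)⟩
    have hxS : x ∈ S := by
      simp only [S, Finset.mem_insert, Finset.mem_filter]
      exact .inr (.inr ⟨hxs, (hS _ (hmem _)).1.trans hx.1.le, hx.2.le.trans (hS _ (hmem _)).2⟩)
    obtain ⟨j, rfl⟩ := hsurj x hxS
    have hj1 := t.lt_iff_lt.1 hx.1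
    have hj2 := t.lt_iff_lt.1 hx.2
    rw [Fin.lt_def] at hj1 hj2
    simp at hj1 hj2
    omega

theorem isPiecewiseC1_segment (a b : E3) : IsPiecewiseC1 (Path.segment a b) := by
  refine isPiecewiseC1_iff_exists_finset.2 ⟨∅, fun x y hx hy _ _ => ?_⟩
  have h : ContDiffOn ℝ 1 (AffineMap.lineMap a b : ℝ → E3) (Icc x y) := by fun_prop
  exact h.congr fun t ht =>
    Path.eqOn_extend_segment a b ⟨hx.trans ht.1, ht.2.trans hy⟩

theorem IsPiecewiseC1.symm {γ : Path a b} (h : IsPiecewiseC1 γ) : IsPiecewiseC1 γ.symm := by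
  classical
  obtain ⟨s, hs⟩ := isPiecewiseC1_iff_exists_finset.1 h
  refine isPiecewiseC1_iff_exists_finset.2 ⟨s.image (1 - ·), fun x y hx hy hxy hd => ?_⟩
  rw [Path.extend_symm]
  refine (hs (1 - y) (1 - x) (by linarith) (by linarith) (by linarith)
    (disjoint_left.2 fun z hz hzs => ?_)).comp (by fun_prop) fun t ht => ?_
  · refine disjoint_left.1 hd (show 1 - z ∈ Ioo x y from ⟨by linarith [hz.2], by linarith [hz.1]⟩) ?_
    simpa using hzs
  · exact ⟨by linarith [ht.2], by linarith [ht.1]⟩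

theorem IsPiecewiseC1.trans {γ : Path a b} {γ' : Path b c} (h : IsPiecewiseC1 γ)
    (h' : IsPiecewiseC1 γ') : IsPiecewiseC1 (γ.trans γ') := by
  classical
  obtain ⟨s, hs⟩ := isPiecewiseC1_iff_exists_finset.1 h
  obtain ⟨s', hs'⟩ := isPiecewiseC1_iff_exists_finset.1 h'
  -- The junction `1 / 2` and the rescaled exceptional points of both halves.
  refine isPiecewiseC1_iff_exists_finset.2
    ⟨{1 / 2} ∪ s.image (· / 2) ∪ s'.image (fun z => (z + 1) / 2), fun x y hx hy hxy hd => ?_⟩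
  simp only [Finset.coe_union, Finset.coe_singleton, Finset.coe_image, disjoint_union_right,
    disjoint_singleton_right] at hd
  obtain ⟨⟨hd, hds⟩, hds'⟩ := hd
  rcases le_or_gt y (1 / 2) with hy2 | hy2
  · refine ContDiffOn.congr ?_ fun t ht => Path.extend_trans_of_le_half _ _ (ht.2.trans hy2)
    refine (hs (2 * x) (2 * y) (by linarith) (by linarith) (by linarith)
      (disjoint_left.2 fun z hz hzs => ?_)).comp (by fun_prop) fun t ht => ?_
    · exact disjoint_left.1 hds (show z / 2 ∈ Ioo x y from ⟨by linarith [hz.1], by linarith [hz.2]⟩) ⟨z, hzs, rfl⟩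
    · exact ⟨by linarith [ht.1], by linarith [ht.2]⟩
  · have hx2 : 1 / 2 ≤ x := by
      by_contra! hx2
      exact hd ⟨hx2, hy2⟩
    refine ContDiffOn.congr ?_ fun t ht => Path.extend_trans_of_half_le _ _ (hx2.trans ht.1)
    refine (hs' (2 * x - 1) (2 * y - 1) (by linarith) (by linarith) (by linarith)
      (disjoint_left.2 fun z hz hzs => ?_)).comp (by fun_prop) fun t ht => ?_
    · exact disjoint_left.1 hds' (show (z + 1) / 2 ∈ Ioo x y from ⟨by linarith [hz.1], by linarith [hz.2]⟩)
        ⟨z, hzs, rfl⟩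
    · exact ⟨by linarith [ht.1], by linarith [ht.2]⟩

variable {Ω : Set E3}

theorem IsCurveIn.symm {γ : Path a b} (h : IsCurveIn Ω γ) : IsCurveIn Ω γ.symm :=
  ⟨h.1.symm, fun _ => h.2 _⟩

theorem IsCurveIn.trans {γ : Path a b} {γ' : Path b c} (h : IsCurveIn Ω γ)
    (h' : IsCurveIn Ω γ') : IsCurveIn Ω (γ.trans γ') := by
  refine ⟨h.1.trans h'.1, fun s => ?_⟩
  rw [Path.trans_apply]
  split_ifs
  exacts [h.2 _, h'.2 _]

theorem isCurveIn_segment {s : Set E3} (hs : Convex ℝ s) (hsΩ : s ⊆ Ω) (ha : a ∈ s) (hb : b ∈ s) :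
    IsCurveIn Ω (Path.segment a b) :=
  ⟨isPiecewiseC1_segment a b, fun t => hsΩ <| by
    simpa using hs.lineMap_mem ha hb t.2⟩

/-! ### Integrals along curves. -/

/-- A continuous 1-form is integrable along every piecewise `C¹` curve. -/
theorem IsCurveIn.curveIntegrable {γ : Path a b} (h : IsCurveIn Ω γ) {ω : E3 → E3 →L[ℝ] ℝ}
    (hω : ContinuousOn ω Ω) : CurveIntegrable ω γ := by
  obtain ⟨⟨n, t, ht, h0, h1, hγ⟩, hΩ⟩ := h
  let T : ℕ → ℝ := fun k => t ⟨min k n, by omega⟩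
  have hT0 : T 0 = 0 := by simpa [T] using h0
  have hTn : T n = 1 := by simpa [T, Fin.last] using h1
  rw [CurveIntegrable, ← hT0, ← hTn]
  refine IntervalIntegrable.trans_iterate fun k hk => ?_
  let i : Fin n := ⟨k, hk⟩
  have hTk : T k = t i.castSucc := by
    simp only [T]; congr 1; ext; simp [i]; omega
  have hTk' : T (k + 1) = t i.succ := by
    simp only [T]; congr 1; ext; simp [i]; omega
  rw [hTk, hTk']
  have hlt : t i.castSucc < t i.succ := ht i.castSucc_lt_succ
  have h0i : 0 ≤ t i.castSucc := h0 ▸ ht.monotone (Fin.zero_le _)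
  have h1i : t i.succ ≤ 1 := h1 ▸ ht.monotone (Fin.le_last _)
  -- With one-sided derivatives at the ends of the piece the integrand is continuous; it differs
  -- from the true one at most at the two end points.
  have hcont : ContinuousOn (fun x => ω (γ.extend x)
      (derivWithin γ.extend (Icc (t i.castSucc) (t i.succ)) x)) (Icc (t i.castSucc) (t i.succ)) :=
    (hω.comp (by fun_prop) fun x _ => hΩ _).clm_apply
      ((hγ i).continuousOn_derivWithin (uniqueDiffOn_Icc hlt) le_rfl)
  refine (hcont.intervalIntegrable_of_Icc hlt.le).congr_ae ?_
  rw [uIoc_of_le hlt.le, ← MeasureTheory.restrict_Ioo_eq_restrict_Ioc]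
  filter_upwards [MeasureTheory.ae_restrict_mem measurableSet_Ioo] with x hx
  rw [curveIntegralFun_def, derivWithin_of_mem_nhds (Icc_mem_nhds hx.1 hx.2),
    derivWithin_of_mem_nhds (Icc_mem_nhds (h0i.trans_lt hx.1) (hx.2.trans_le h1i))]

/-- The integral of an exact 1-form along a piecewise `C¹` curve is the increment of a primitive. -/
theorem IsCurveIn.curveIntegral_eq_sub {γ : Path a b} (h : IsCurveIn Ω γ)
    {ω : E3 → E3 →L[ℝ] ℝ} (hω : ContinuousOn ω Ω) {u : E3 → ℝ}
    (hu : ∀ p ∈ Ω, HasFDerivAt u (ω p) p) : curveIntegral ω γ = u b - u a := by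
  have hint := h.curveIntegrable hω
  obtain ⟨s, hs⟩ := isPiecewiseC1_iff_exists_finset.1 h.1
  rw [curveIntegral_def]
  have key := MeasureTheory.integral_eq_of_hasDerivAt_off_countable_of_le (u ∘ γ.extend)
    (curveIntegralFun ω γ) zero_le_one s.countable_toSet ?_ ?_ hint
  · simpa using key
  · exact ContinuousOn.comp (t := Ω) (fun p hp => (hu p hp).continuousAt.continuousWithinAt)
      (by fun_prop) fun x _ => h.2 _
  · rintro x ⟨hx, hxs⟩
    have hnhds : Ioo 0 1 ∩ (s : Set ℝ)ᶜ ∈ 𝓝 x :=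
      (isOpen_Ioo.inter s.finite_toSet.isClosed.isOpen_compl).mem_nhds ⟨hx, hxs⟩
    obtain ⟨l, r, hlr, hsub⟩ := mem_nhds_iff_exists_Ioo_subset.1 hnhds
    have hl : 0 ≤ l ∧ r ≤ 1 := by
      have : Ioo l r ⊆ Ioo 0 1 := fun z hz => (hsub hz).1
      exact (Ioo_subset_Ioo_iff (hlr.1.trans hlr.2)).1 this
    have hdiff : DifferentiableAt ℝ γ.extend x :=
      ((hs l r hl.1 hl.2 (hlr.1.trans hlr.2)
        (disjoint_left.2 fun z hz => (hsub hz).2)).differentiableOn (by simp)).differentiableAt (Icc_mem_nhds hlr.1 hlr.2)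
    rw [curveIntegralFun_def, derivWithin_of_mem_nhds (Icc_mem_nhds hx.1 hx.2)]
    exact (hu _ (h.2 _)).comp_hasDerivAt x hdiff.hasDerivAt

end SpaceField

/-! ### The implications between the conditions. -/

namespace SpaceField

variable {Ω : Set E3} {P Q R : E3 → ℝ}

theorem continuousOn_form (hP : ∀ p ∈ Ω, DifferentiableAt ℝ P p)
    (hQ : ∀ p ∈ Ω, DifferentiableAt ℝ Q p) (hR : ∀ p ∈ Ω, DifferentiableAt ℝ R p) :
    ContinuousOn (form P Q R) Ω := fun p hp =>
  (hasFDerivAt_form (hP p hp) (hQ p hp) (hR p hp)).continuousAt.continuousWithinAt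

theorem isPotentialOf_iff_hasDifferential {u : E3 → ℝ} :
    IsPotentialOf Ω P Q R u ↔ HasDifferential Ω P Q R u :=
  forall₂_congr fun _ _ => hasGradientAt_field_iff

theorem HasDifferential.hasPartials {u : E3 → ℝ} (h : HasDifferential Ω P Q R u) :
    HasPartials Ω P Q R u := fun p hp => by
  obtain ⟨h0, h1, h2⟩ := form_axis P Q R p
  have key (i : Fin 3) := (h p hp).hasLineDerivAt (axis i)
  exact ⟨h0 ▸ key 0, h1 ▸ key 1, h2 ▸ key 2⟩

theorem HasPartials.hasDifferential (hΩ : IsOpen Ω) {u : E3 → ℝ} (h : HasPartials Ω P Q R u)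
    (hP : ContinuousOn P Ω) (hQ : ContinuousOn Q Ω) (hR : ContinuousOn R Ω) :
    HasDifferential Ω P Q R u := fun _ hp =>
  hasFDerivAt_of_hasPartials (eventually_of_mem (hΩ.mem_nhds hp) h)
    (hP.continuousAt (hΩ.mem_nhds hp)) (hQ.continuousAt (hΩ.mem_nhds hp))
    (hR.continuousAt (hΩ.mem_nhds hp))

theorem isIrrotational_iff_fderiv_form_symm (hP : ∀ p ∈ Ω, DifferentiableAt ℝ P p)
    (hQ : ∀ p ∈ Ω, DifferentiableAt ℝ Q p) (hR : ∀ p ∈ Ω, DifferentiableAt ℝ R p) :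
    IsIrrotational Ω P Q R ↔
      ∀ p ∈ Ω, ∀ v w, fderiv ℝ (form P Q R) p v w = fderiv ℝ (form P Q R) p w v :=
  forall₂_congr fun p hp => curl_eq_zero_iff (hP p hp) (hQ p hp) (hR p hp)

/-- If the integrals of a continuous 1-form along closed curves vanish, then it has primitives
locally. -/
theorem ClosedIntegralsVanish.exists_eventually_hasFDerivAt (hΩ : IsOpen Ω)
    (hω : ContinuousOn (form P Q R) Ω) (h : ClosedIntegralsVanish Ω P Q R) {p : E3} (hp : p ∈ Ω) :
    ∃ f : E3 → ℝ, ∀ᶠ q in 𝓝 p, HasFDerivAt f (form P Q R q) q := by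
  obtain ⟨ε, hε, hball⟩ := Metric.isOpen_iff.1 hΩ p hp
  have hpB : p ∈ Metric.ball p ε := Metric.mem_ball_self hε
  have hseg {x y : E3} (hx : x ∈ Metric.ball p ε) (hy : y ∈ Metric.ball p ε) :
      IsCurveIn Ω (Path.segment x y) := isCurveIn_segment (convex_ball p ε) hball hx hy
  refine ⟨fun b => curveIntegral (form P Q R) (Path.segment p b), ?_⟩
  filter_upwards [Metric.ball_mem_nhds p hε] with q hq
  -- By the triangle `p`, `q`, `b`, the candidate at `b` is a constant plus the integral from `q` to
  -- `b`, so only the derivative of the latter at `b = q` is needed.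
  have hsrc := (HasFDerivWithinAt.curveIntegral_segment_source (convex_ball p ε)
    (hω.mono hball) hq).hasFDerivAt (Metric.isOpen_ball.mem_nhds hq)
  refine (hsrc.const_add (curveIntegral (form P Q R) (Path.segment p q))).congr_of_eventuallyEq ?_
  filter_upwards [Metric.isOpen_ball.mem_nhds hq] with b hb
  have hpq := hseg hpB hq
  have hqb := hseg hq hb
  have hbp := (hseg hpB hb).symm
  have hzero := h p _ ((hpq.trans hqb).trans hbp)
  rw [curveIntegral_trans ((hpq.trans hqb).curveIntegrable hω) (hbp.curveIntegrable hω),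
    curveIntegral_trans (hpq.curveIntegrable hω) (hqb.curveIntegrable hω),
    curveIntegral_symm] at hzero
  linarith

theorem ClosedIntegralsVanish.isIrrotational (hΩ : IsOpen Ω)
    (hP : ∀ p ∈ Ω, DifferentiableAt ℝ P p) (hQ : ∀ p ∈ Ω, DifferentiableAt ℝ Q p)
    (hR : ∀ p ∈ Ω, DifferentiableAt ℝ R p) (h : ClosedIntegralsVanish Ω P Q R) :
    IsIrrotational Ω P Q R := by
  rw [isIrrotational_iff_fderiv_form_symm hP hQ hR]
  intro p hp
  obtain ⟨f, hf⟩ := h.exists_eventually_hasFDerivAt hΩ (continuousOn_form hP hQ hR) hp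
  exact second_derivative_symmetric_of_eventually hf
    (hasFDerivAt_form (hP p hp) (hQ p hp) (hR p hp)).differentiableAt.hasFDerivAt

theorem IsIrrotational.exists_hasDifferential (hΩ : IsOpen Ω) (hsc : IsSimplyConnected Ω)
    (hP : ∀ p ∈ Ω, DifferentiableAt ℝ P p) (hQ : ∀ p ∈ Ω, DifferentiableAt ℝ Q p)
    (hR : ∀ p ∈ Ω, DifferentiableAt ℝ R p) (h : IsIrrotational Ω P Q R) :
    ∃ u : E3 → ℝ, HasDifferential Ω P Q R u := by
  rw [isIrrotational_iff_fderiv_form_symm hP hQ hR] at h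
  refine hsc.exists_forall_hasFDerivAt hΩ fun p hp => ?_
  obtain ⟨ε, hε, hball⟩ := Metric.isOpen_iff.1 hΩ p hp
  obtain ⟨f, hf⟩ := (convex_ball p ε).exists_forall_hasFDerivAt_of_fderiv_symmetric
    Metric.isOpen_ball
    (fun q hq => (hasFDerivAt_form (hP q (hball hq)) (hQ q (hball hq))
      (hR q (hball hq))).differentiableAt.differentiableWithinAt)
    (fun q hq => h q (hball hq))
  exact ⟨f, eventually_of_mem (Metric.ball_mem_nhds p hε) hf⟩

theorem HasDifferential.closedIntegralsVanish (hω : ContinuousOn (form P Q R) Ω) {u : E3 → ℝ}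
    (hu : HasDifferential Ω P Q R u) : ClosedIntegralsVanish Ω P Q R := fun a C hC => by
  rw [hC.curveIntegral_eq_sub hω hu, sub_self]

theorem ClosedIntegralsVanish.isPathIndependent (hω : ContinuousOn (form P Q R) Ω)
    (h : ClosedIntegralsVanish Ω P Q R) : IsPathIndependent Ω P Q R := by
  intro a _ b _ _ L₁ L₂ h₁ h₂
  have := h a _ (h₁.trans h₂.symm)
  rw [curveIntegral_trans (h₁.curveIntegrable hω) (h₂.symm.curveIntegrable hω),
    curveIntegral_symm] at this
  linarith

theorem IsPathIndependent.closedIntegralsVanish (hΩ : IsOpen Ω)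
    (hω : ContinuousOn (form P Q R) Ω) (h : IsPathIndependent Ω P Q R) :
    ClosedIntegralsVanish Ω P Q R := by
  intro a C hC
  have ha : a ∈ Ω := C.source ▸ hC.2 0
  obtain ⟨ε, hε, hball⟩ := Metric.isOpen_iff.1 hΩ a ha
  -- Path independence concerns distinct end points only, so a short segment `L` to some `b ≠ a` is
  -- appended to the loop and compared with `L` alone.
  obtain ⟨b, hb, hba⟩ : ∃ b ∈ Metric.ball a ε, b ≠ a := by
    refine ⟨a + (ε / 2) • axis 0, ?_, ?_⟩
    · rw [Metric.mem_ball, dist_eq_norm, add_sub_cancel_left, norm_smul,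
        Real.norm_of_nonneg (half_pos hε).le]
      simpa [axis] using hε
    · simp [axis, hε.ne']
  have hL := isCurveIn_segment (convex_ball a ε) hball (Metric.mem_ball_self hε) hb
  have := h a ha b (hball hb) hba.symm _ _ (hC.trans hL) hL
  rw [curveIntegral_trans (hC.curveIntegrable hω) (hL.curveIntegrable hω)] at this
  linarith

end SpaceField

end

theorem theorem2 (Ω : Set SpaceField.E3) (hΩ_open : IsOpen Ω) (hΩ : IsSimplyConnected Ω)
    (P Q R : SpaceField.E3 → ℝ)
    (hP : ∀ p ∈ Ω, DifferentiableAt ℝ P p)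
    (hQ : ∀ p ∈ Ω, DifferentiableAt ℝ Q p)
    (hR : ∀ p ∈ Ω, DifferentiableAt ℝ R p) :
    List.TFAE
      [SpaceField.ClosedIntegralsVanish Ω P Q R,
       SpaceField.IsPathIndependent Ω P Q R,
       ∃ u : SpaceField.E3 → ℝ, SpaceField.IsPotentialOf Ω P Q R u,
       SpaceField.IsIrrotational Ω P Q R] ∧
    ∀ u : SpaceField.E3 → ℝ, List.TFAE
      [SpaceField.IsPotentialOf Ω P Q R u,
       SpaceField.HasDifferential Ω P Q R u,
       SpaceField.HasPartials Ω P Q R u] := by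
  have hω := SpaceField.continuousOn_form hP hQ hR
  have hcont {f : SpaceField.E3 → ℝ} (hf : ∀ p ∈ Ω, DifferentiableAt ℝ f p) : ContinuousOn f Ω :=
    fun p hp => (hf p hp).continuousAt.continuousWithinAt
  constructor
  · tfae_have 1 → 2 := fun h => h.isPathIndependent hω
    tfae_have 2 → 1 := fun h => h.closedIntegralsVanish hΩ_open hω
    tfae_have 1 → 4 := fun h => h.isIrrotational hΩ_open hP hQ hR
    tfae_have 4 → 3 := fun h =>
      (h.exists_hasDifferential hΩ_open hΩ hP hQ hR).imp fun _ hu =>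
        SpaceField.isPotentialOf_iff_hasDifferential.2 hu
    tfae_have 3 → 1 := fun ⟨_, hu⟩ =>
      (SpaceField.isPotentialOf_iff_hasDifferential.1 hu).closedIntegralsVanish hω
    tfae_finish
  · intro u
    tfae_have 1 ↔ 2 := SpaceField.isPotentialOf_iff_hasDifferential
    tfae_have 2 → 3 := fun h => h.hasPartials
    tfae_have 3 → 2 := fun h => h.hasDifferential hΩ_open (hcont hP) (hcont hQ) (hcont hR)
    tfae_finish
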